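/- Let $\Omega\subset\mathbb{R}^n$ be a bounded domain with smooth boundary and outer unit normal $\nu$, let $d_1,d_2,d_3>0$, $k>0$ and $\alpha\in\mathbb{R}$, and let $\lambda_1$ be the first nonzero eigenvalue of $-\Delta$ on $\Omega$ with homogeneous Neumann boundary condition. Let $u=(u_1,u_2,u_3)$ be a global classical solution of the Newton--Leipnik reaction--diffusion system $$\partial_t u_1-d_1\Delta u_1=-0.4u_1+u_2+10u_2u_3,\quad \partial_t u_2-d_2\Delta u_2=-u_1-0.4u_2+5u_1u_3,\quad \partial_t u_3-d_3\Delta u_3=\alpha u_3-5u_1u_2$$ in $(0,\infty)\times\Omega$, with $\partial u_i/\partial\nu=0$ on $(0,\infty)\times\partial\Omega$. Consider the synchronization error system for $E=(e_1,e_2,e_3)^T$, $$\partial_t E-D\Delta E=AE \ \text{ in } \Omega,\qquad \frac{\partial e_i}{\partial\nu}=0\ \text{ on } \partial\Omega,$$ $$D=\mathrm{diag}(d_1,d_2,d_3),\qquad A=\begin{pmatrix}-0.4&1+10u_3&5u_2\\-1-10u_3&-0.4&5v_1\\-5u_2&-5v_1&-k\end{pmatrix},\qquad v_1=u_1+e_1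 .$$ Suppose that $$\frac{0.52+100u_3^2+20u_3}{1.6+2k}<d_3\lambda_1$$ at every point of $(0,\infty)\times\Omega$. Then the constant steady state $(0,0,0)$ of the error system is locally asymptotically stable in $L^2(\Omega)^3$: the zero function is a solution; for every $\varepsilon>0$ there is $\delta>0$ such that every classical solution $E$ on a time interval $[0,T)$, $0<T\le\infty$, with $\|E(0)\|_{L^2}<\delta$ satisfies $\|E(t)\|_{L^2}<\varepsilon$ for all $t\in[0,T)$; and there is $\delta>0$ such that every global classical solution with $\|E(0)\|_{L^2}<\delta$ satisfies $\|E(t)\|_{L^2}\to0$ as $t\to\infty$. Here a classical solution on $[0,T)$ is a solution whose components are continuous on $[0,T)\times\overline\Omega$ and of class $C^1$ in time and $C^2$ in space on $(0,T)\times\overline\Omega$. -/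

import Mathlib

open Set Filter Topology MeasureTheory
open scoped ContDiff Gradient

noncomputable section

namespace NewtonLeipnik

/-- A bounded domain (nonempty, connected, open) of `ℝⁿ` with smooth boundary, presented by a
smooth defining function: the domain is `{ρ < 0}` and `∇ρ` does not vanish on `{ρ = 0}`, so that
`{ρ = 0}` is the boundary. -/
structure SmoothBoundedDomain (n : ℕ) where
  /-- the underlying open set -/
  carrier : Set (EuclideanSpace ℝ (Fin n))
  /-- a defining function of the domain -/
  ρ : EuclideanSpace ℝ (Fin n) → ℝ
  smooth_ρ : ContDiff ℝ ∞ ρ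
  carrier_eq : carrier = {x | ρ x < 0}
  regular : ∀ x, ρ x = 0 → ∇ ρ x ≠ 0
  isBounded : Bornology.IsBounded carrier
  isConnected : IsConnected carrier

variable {n : ℕ}

/-- The unit outer normal `∇ρ / |∇ρ|` at a boundary point. -/
def SmoothBoundedDomain.normal (Ω : SmoothBoundedDomain n) (x : EuclideanSpace ℝ (Fin n)) :
    EuclideanSpace ℝ (Fin n) :=
  ‖∇ Ω.ρ x‖⁻¹ • ∇ Ω.ρ x

/-- The homogeneous Neumann condition `∂w/∂ν = 0` on `∂Ω`, for `w` of class `C¹` up to the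
boundary. -/
def NeumannCondition (Ω : SmoothBoundedDomain n) (w : EuclideanSpace ℝ (Fin n) → ℝ) : Prop :=
  ∀ x ∈ frontier Ω.carrier, fderivWithin ℝ w (closure Ω.carrier) x (Ω.normal x) = 0

/-- `μ` is an eigenvalue of `-Δ` on `Ω` with homogeneous Neumann boundary condition. -/
def IsNeumannEigenvalue (Ω : SmoothBoundedDomain n) (μ : ℝ) : Prop :=
  ∃ φ : EuclideanSpace ℝ (Fin n) → ℝ,
    ContDiffOn ℝ 2 φ (closure Ω.carrier) ∧
    (∃ x ∈ Ω.carrier, φ x ≠ 0) ∧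
    (∀ x ∈ Ω.carrier, -Laplacian.laplacian φ x = μ * φ x) ∧
    NeumannCondition Ω φ

/-- `μ` is the first nonzero Neumann eigenvalue of `-Δ` on `Ω`. -/
def IsFirstNonzeroNeumannEigenvalue (Ω : SmoothBoundedDomain n) (μ : ℝ) : Prop :=
  IsLeast {μ' : ℝ | 0 < μ' ∧ IsNeumannEigenvalue Ω μ'} μ

/-- The time interval `[0, T)`, where `T = ⊤` means `[0, ∞)`. -/
def timeInterval (T : EReal) : Set ℝ := {t : ℝ | 0 ≤ t ∧ (t : EReal) < T}

/-- The open time interval `(0, T)`. -/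
def openTimeInterval (T : EReal) : Set ℝ := {t : ℝ | 0 < t ∧ (t : EReal) < T}

/-- The regularity of classical solutions on `[0, T)`: `w` is continuous on `[0, T) × Ω̄` and of
class `C¹` in time and `C²` in space on `(0, T) × Ω̄`. The first argument of `w` is the time. -/
structure ClassicalRegularity (Ω : SmoothBoundedDomain n) (T : EReal)
    (w : ℝ → EuclideanSpace ℝ (Fin n) → ℝ) : Prop where
  continuousOn :
    ContinuousOn (fun p : ℝ × EuclideanSpace ℝ (Fin n) => w p.1 p.2)
      (timeInterval T ×ˢ closure Ω.carrier)
  contDiffOn_space : ∀ t ∈ openTimeInterval T, ContDiffOn ℝ 2 (w t) (closure Ω.carrier)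
  continuousOn_fderiv :
    ContinuousOn (fun p : ℝ × EuclideanSpace ℝ (Fin n) =>
      fderivWithin ℝ (w p.1) (closure Ω.carrier) p.2)
      (openTimeInterval T ×ˢ closure Ω.carrier)
  continuousOn_fderiv_two :
    ContinuousOn (fun p : ℝ × EuclideanSpace ℝ (Fin n) =>
      iteratedFDerivWithin ℝ 2 (w p.1) (closure Ω.carrier) p.2)
      (openTimeInterval T ×ˢ closure Ω.carrier)
  differentiableAt_time : ∀ t ∈ openTimeInterval T, ∀ x ∈ closure Ω.carrier,
    DifferentiableAt ℝ (fun s => w s x) t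
  continuousOn_deriv :
    ContinuousOn (fun p : ℝ × EuclideanSpace ℝ (Fin n) => deriv (fun s => w s p.2) p.1)
      (openTimeInterval T ×ˢ closure Ω.carrier)

/-- `w = (w₁, w₂, w₃)` is a classical solution on `[0, T)` of the reaction-diffusion system
`∂wᵢ/∂t - dᵢ Δwᵢ = Fᵢ(t, x, w)` in `Ω`, `∂wᵢ/∂ν = 0` on `∂Ω`. -/
structure IsClassicalSolution (Ω : SmoothBoundedDomain n) (T : EReal) (d : Fin 3 → ℝ)
    (F : ℝ → EuclideanSpace ℝ (Fin n) → (Fin 3 → ℝ) → Fin 3 → ℝ)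
    (w : Fin 3 → ℝ → EuclideanSpace ℝ (Fin n) → ℝ) : Prop where
  regularity : ∀ i, ClassicalRegularity Ω T (w i)
  equation : ∀ i, ∀ t ∈ openTimeInterval T, ∀ x ∈ Ω.carrier,
    deriv (fun s => w i s x) t - d i * Laplacian.laplacian (w i t) x =
      F t x (fun j => w j t x) i
  neumann : ∀ i, ∀ t ∈ openTimeInterval T, NeumannCondition Ω (w i t)

/-- The Newton-Leipnik reaction terms of the master system. -/
def masterReaction (α : ℝ) (u : Fin 3 → ℝ) : Fin 3 → ℝ :=
  ![-0.4 * u 0 + u 1 + 10 * u 1 * u 2,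
    -u 0 - 0.4 * u 1 + 5 * u 0 * u 2,
    α * u 2 - 5 * u 0 * u 1]

/-- The matrix `A` of the controlled synchronization error system. -/
def errorMatrix (k : ℝ) (u v : Fin 3 → ℝ) : Matrix (Fin 3) (Fin 3) ℝ :=
  !![-0.4, 1 + 10 * u 2, 5 * u 1;
     -1 - 10 * u 2, -0.4, 5 * v 0;
     -5 * u 1, -5 * v 0, -k]

/-- `u` is a global classical solution of the master system. -/
def IsMasterSolution (Ω : SmoothBoundedDomain n) (d : Fin 3 → ℝ) (α : ℝ)
    (u : Fin 3 → ℝ → EuclideanSpace ℝ (Fin n) → ℝ) : Prop :=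
  IsClassicalSolution Ω ⊤ d (fun _ _ w => masterReaction α w) u

/-- `e` is a classical solution on `[0, T)` of the error system `∂E/∂t - D ΔE = A E`, where `A` is
evaluated at the master state `u` and at the slave state `v = u + e`. -/
def IsErrorSolution (Ω : SmoothBoundedDomain n) (d : Fin 3 → ℝ) (k : ℝ)
    (u : Fin 3 → ℝ → EuclideanSpace ℝ (Fin n) → ℝ) (T : EReal)
    (e : Fin 3 → ℝ → EuclideanSpace ℝ (Fin n) → ℝ) : Prop :=
  IsClassicalSolution Ω T d
    (fun t x w => (errorMatrix k (fun j => u j t x) (fun j => u j t x + w j)).mulVec w) e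

/-- The norm of `L²(Ω)³`. -/
def l2Norm (Ω : SmoothBoundedDomain n) (f : Fin 3 → EuclideanSpace ℝ (Fin n) → ℝ) : ℝ :=
  √(∑ i, ∫ x in Ω.carrier, f i x ^ 2)

/-- Local asymptotic stability, in `L²(Ω)³`, of the zero steady state of the evolution problem whose
solutions on `[0, T)` are the `e` with `Sol T e`: zero is a solution; it is Lyapunov stable (on the
whole interval of existence of each solution); and it attracts the global solutions that start
near it. -/
def ZeroLocallyAsymptoticallyStable (Ω : SmoothBoundedDomain n)
    (Sol : EReal → (Fin 3 → ℝ → EuclideanSpace ℝ (Fin n) → ℝ) → Prop) : Prop :=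
  Sol ⊤ (fun _ _ _ => 0) ∧
  (∀ ε > 0, ∃ δ > 0, ∀ (T : EReal) (e : Fin 3 → ℝ → EuclideanSpace ℝ (Fin n) → ℝ), Sol T e →
    l2Norm Ω (fun i => e i 0) < δ → ∀ t ∈ timeInterval T, l2Norm Ω (fun i => e i t) < ε) ∧
  (∃ δ > 0, ∀ e : Fin 3 → ℝ → EuclideanSpace ℝ (Fin n) → ℝ, Sol ⊤ e →
    l2Norm Ω (fun i => e i 0) < δ →
      Tendsto (fun t : ℝ => l2Norm Ω (fun i => e i t)) atTop (𝓝 0))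

end NewtonLeipnik

end

/-! The proof is an energy estimate that is exact rather than linearised. Off its diagonal,
`errorMatrix` is skew-symmetric whatever the values of `u` and `v`, so `⟨E, A E⟩ = -(0.4 e₁² + 0.4
e₂² + k e₃²)` (`sum_mul_errorMatrix_mulVec`): the nonlinear coupling through `v₁` cancels. By
Green's identity and the Neumann condition, diffusion contributes `-2 ∑ dᵢ ∫ |∇eᵢ|² ≤ 0`. With `m =
min 0.4 k > 0` this gives `d/dt ‖E‖² ≤ -2m ‖E‖²`, hence `‖E(t)‖ ≤ exp(-m t) ‖E(0)‖` for data of any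
size (`IsErrorSolution.l2Norm_le`), and both halves of stability follow.

The analytic work lies in Green's identity on `{ρ < 0}`. It rests on the divergence theorem for
tangential `C¹` fields `G`, obtained without surface integrals: cut `G` off near the boundary,
integrate over the whole space, and let the cutoff tend to `1`. The error term contains the
derivative of the cutoff, of order `N`, on a layer where `|ρ|` is at most of order `1/N`; it stays
bounded because `G · ∇ρ` vanishes on the boundary and so is `O(|ρ|)` (`exists_abs_le_mul_abs_ρ`).
Dominated convergence then removes it. -/

namespace NewtonLeipnik

/-! ### Geometry of the domain near its boundary -/

section Geometry

variable {n : ℕ} (Ω : SmoothBoundedDomain n)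

lemma SmoothBoundedDomain.mem_carrier {x : EuclideanSpace ℝ (Fin n)} :
    x ∈ Ω.carrier ↔ Ω.ρ x < 0 := by
  rw [Ω.carrier_eq]; rfl

lemma SmoothBoundedDomain.isOpen_carrier : IsOpen Ω.carrier := by
  rw [Ω.carrier_eq]
  exact isOpen_lt Ω.smooth_ρ.continuous continuous_const

lemma SmoothBoundedDomain.isCompact_closure : IsCompact (closure Ω.carrier) :=
  Ω.isBounded.isCompact_closure

lemma SmoothBoundedDomain.differentiable_ρ : Differentiable ℝ Ω.ρ :=
  Ω.smooth_ρ.differentiable (by simp)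

lemma SmoothBoundedDomain.continuous_fderiv_ρ : Continuous (fderiv ℝ Ω.ρ) :=
  Ω.smooth_ρ.continuous_fderiv (by simp)

lemma SmoothBoundedDomain.ρ_nonpos {x : EuclideanSpace ℝ (Fin n)}
    (hx : x ∈ closure Ω.carrier) : Ω.ρ x ≤ 0 := by
  have h : closure Ω.carrier ⊆ {x | Ω.ρ x ≤ 0} :=
    closure_minimal (fun y hy => (Ω.mem_carrier.1 hy).le)
      (isClosed_le Ω.smooth_ρ.continuous continuous_const)
  exact h hx

lemma SmoothBoundedDomain.mem_frontier_iff {x : EuclideanSpace ℝ (Fin n)} :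
    x ∈ frontier Ω.carrier ↔ x ∈ closure Ω.carrier ∧ Ω.ρ x = 0 := by
  rw [frontier, Ω.isOpen_carrier.interior_eq, Set.mem_sdiff, Ω.mem_carrier, not_lt]
  constructor
  · rintro ⟨h, h'⟩
    exact ⟨h, le_antisymm (Ω.ρ_nonpos h) h'⟩
  · rintro ⟨h, h'⟩
    exact ⟨h, h'.ge⟩

lemma SmoothBoundedDomain.fderiv_ρ_apply (x v : EuclideanSpace ℝ (Fin n)) :
    fderiv ℝ Ω.ρ x v = inner ℝ (∇ Ω.ρ x) v := by
  simp [gradient]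

lemma SmoothBoundedDomain.fderiv_ρ_gradient_pos {x : EuclideanSpace ℝ (Fin n)}
    (hx : Ω.ρ x = 0) : 0 < fderiv ℝ Ω.ρ x (∇ Ω.ρ x) := by
  rw [Ω.fderiv_ρ_apply]
  exact real_inner_self_pos.2 (Ω.regular x hx)

/-- Directions along which `ρ` decreases are tangent to the domain at a boundary point. -/
lemma SmoothBoundedDomain.mem_tangentConeAt {x v : EuclideanSpace ℝ (Fin n)}
    (hx : Ω.ρ x = 0) (hv : fderiv ℝ Ω.ρ x v < 0) : v ∈ tangentConeAt ℝ Ω.carrier x := by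
  have hd : HasDerivAt (fun s : ℝ => Ω.ρ (x + s • v)) (fderiv ℝ Ω.ρ x v) 0 := by
    have h1 : HasDerivAt (fun s : ℝ => x + s • v) v 0 := by
      simpa using ((hasDerivAt_id (0 : ℝ)).smul_const v).const_add x
    have h2 : HasFDerivAt Ω.ρ (fderiv ℝ Ω.ρ x) (x + (0 : ℝ) • v) := by
      simpa using (Ω.differentiable_ρ x).hasFDerivAt
    exact h2.comp_hasDerivAt (0 : ℝ) h1
  -- Approach `x` by the points `x + s • v` as `s → 0⁺`, rescaled by `s⁻¹`.
  refine mem_tangentConeAt_of_seq (𝓝[>] (0 : ℝ)) (fun s => s⁻¹) (fun s => s • v) ?_ ?_ ?_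
  · have : Tendsto (fun s : ℝ => s • v) (𝓝 0) (𝓝 ((0 : ℝ) • v)) := by
      exact (continuous_id.smul continuous_const).tendsto 0
    rw [zero_smul] at this
    exact this.mono_left nhdsWithin_le_nhds
  · have h := hd.hasDerivWithinAt (s := Ioi 0)
    rw [hasDerivWithinAt_iff_tendsto_slope' (by simp)] at h
    filter_upwards [h.eventually_lt_const hv, self_mem_nhdsWithin] with s hs hs0
    have hs0' : (0 : ℝ) < s := hs0
    rw [slope_def_field] at hs
    simp only [zero_smul, add_zero, hx, sub_zero] at hs
    rw [Ω.mem_carrier]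
    by_contra hcon
    exact absurd hs (not_lt.2 (div_nonneg (not_lt.1 hcon) hs0'.le))
  · refine tendsto_const_nhds.congr' ?_
    filter_upwards [self_mem_nhdsWithin] with s hs
    have hs0 : (s : ℝ) ≠ 0 := ne_of_gt hs
    rw [smul_smul, inv_mul_cancel₀ hs0, one_smul]

/-- At a boundary point the tangent cone contains the open half-space where `dρ < 0`. This
half-space is nonempty, since it contains `-∇ρ`, and a subspace with nonempty interior is
everything. This is what makes `fderivWithin` on the closure well behaved up to the boundary. -/
lemma SmoothBoundedDomain.uniqueDiffOn_closure : UniqueDiffOn ℝ (closure Ω.carrier) := by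
  intro x hx
  by_cases hxΩ : x ∈ Ω.carrier
  · exact (Ω.isOpen_carrier.uniqueDiffWithinAt hxΩ).closure
  have hx0 : Ω.ρ x = 0 :=
    le_antisymm (Ω.ρ_nonpos hx) (not_lt.1 fun h => hxΩ (Ω.mem_carrier.2 h))
  have hsub : {v | fderiv ℝ Ω.ρ x v < 0} ⊆
      (Submodule.span ℝ (tangentConeAt ℝ Ω.carrier x) : Set (EuclideanSpace ℝ (Fin n))) :=
    fun v hv => Submodule.subset_span (Ω.mem_tangentConeAt hx0 hv)
  have hopen : IsOpen {v | fderiv ℝ Ω.ρ x v < 0} :=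
    isOpen_lt (fderiv ℝ Ω.ρ x).continuous continuous_const
  have htop : Submodule.span ℝ (tangentConeAt ℝ Ω.carrier x) = ⊤ := by
    refine Submodule.eq_top_of_nonempty_interior' _ ⟨-∇ Ω.ρ x, ?_⟩
    refine interior_maximal hsub hopen ?_
    simpa using Ω.fderiv_ρ_gradient_pos hx0
  refine UniqueDiffWithinAt.closure ⟨?_, hx⟩
  rw [htop]
  exact dense_univ

/-- A segment leaving `x ∈ Ω` along a direction in which `ρ` increases at rate at least `c` meets
the boundary before time `-ρ x / c`, and stays in `Ω` until then. -/
lemma SmoothBoundedDomain.exists_exit {x v : EuclideanSpace ℝ (Fin n)} {c : ℝ} (hc : 0 < c)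
    (hx : x ∈ Ω.carrier)
    (hv : ∀ s ∈ Icc 0 (-Ω.ρ x / c), c ≤ fderiv ℝ Ω.ρ (x + s • v) v) :
    ∃ s ∈ Icc 0 (-Ω.ρ x / c), x + s • v ∈ frontier Ω.carrier ∧
      segment ℝ x (x + s • v) ⊆ closure Ω.carrier := by
  have hx' := Ω.mem_carrier.1 hx
  set S := -Ω.ρ x / c with hS
  have hS0 : 0 ≤ S := div_nonneg (by linarith) hc.le
  set f : ℝ → ℝ := fun s => Ω.ρ (x + s • v) with hf
  have hd : ∀ s, HasDerivAt f (fderiv ℝ Ω.ρ (x + s • v) v) s := by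
    intro s
    have h1 : HasDerivAt (fun s : ℝ => x + s • v) v s := by
      simpa using ((hasDerivAt_id s).smul_const v).const_add x
    exact (Ω.differentiable_ρ _).hasFDerivAt.comp_hasDerivAt s h1
  have hcont : Continuous f := continuous_iff_continuousAt.2 fun s => (hd s).continuousAt
  -- Growth at rate at least `c`: the length `S` is chosen so that `ρ x + c * S = 0`, which forces a
  -- sign change on `[0, S]`. Strict growth also gives `ρ < 0` before the zero found.
  have hmono := (convex_Icc 0 S).mul_sub_le_image_sub_of_le_deriv hcont.continuousOn
    (fun s _ => (hd s).differentiableAt.differentiableWithinAt) (C := c)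
    (fun s hs => by rw [(hd s).deriv]; exact hv s (interior_subset hs))
  have hf0 : f 0 = Ω.ρ x := by simp [hf]
  have hfS : 0 ≤ f S := by
    have := hmono 0 (left_mem_Icc.2 hS0) S (right_mem_Icc.2 hS0) hS0
    rw [hf0, sub_zero, hS, mul_div_cancel₀ _ hc.ne'] at this
    linarith
  obtain ⟨s, hs, hs0⟩ := intermediate_value_Icc hS0 hcont.continuousOn
    (show (0 : ℝ) ∈ Icc (f 0) (f S) from ⟨by rw [hf0]; exact hx'.le, hfS⟩)
  have hlt : ∀ t ∈ Ico 0 s, x + t • v ∈ Ω.carrier := by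
    intro t ht
    have := hmono t ⟨ht.1, ht.2.le.trans hs.2⟩ s hs ht.2.le
    have h2 : 0 < c * (s - t) := mul_pos hc (sub_pos.2 ht.2)
    rw [Ω.mem_carrier]
    change f t < 0
    linarith
  have hs_pos : 0 < s := by
    rcases hs.1.eq_or_lt with h | h
    · rw [← h, hf0] at hs0; linarith
    · exact h
  have hcl : ∀ t ∈ Icc 0 s, x + t • v ∈ closure Ω.carrier := by
    intro t ht
    have h1 : t ∈ closure (Ico 0 s) := by rwa [closure_Ico hs_pos.ne]
    have h2 : Continuous fun t : ℝ => x + t • v := by fun_prop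
    exact map_mem_closure (f := fun t : ℝ => x + t • v) h2 h1 hlt
  refine ⟨s, hs, Ω.mem_frontier_iff.2 ⟨hcl s (right_mem_Icc.2 hs.1), hs0⟩, ?_⟩
  rw [segment_eq_image']
  rintro _ ⟨θ, hθ, rfl⟩
  have := hcl (θ * s) ⟨mul_nonneg hθ.1 hs.1, mul_le_of_le_one_left hs.1 hθ.2⟩
  simpa [smul_smul] using this

/-- A `C¹` function on `Ω̄` vanishing on the boundary is bounded by a multiple of the defining
function. -/
lemma SmoothBoundedDomain.exists_abs_le_mul_abs_ρ {g : EuclideanSpace ℝ (Fin n) → ℝ}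
    (hg : ContDiffOn ℝ 1 g (closure Ω.carrier)) (hg0 : ∀ x ∈ frontier Ω.carrier, g x = 0) :
    ∃ C, 0 ≤ C ∧ ∀ x ∈ Ω.carrier, |g x| ≤ C * |Ω.ρ x| := by
  obtain ⟨K, hK⟩ := Ω.isCompact_closure.exists_bound_of_continuousOn
    (hg.continuousOn_fderivWithin Ω.uniqueDiffOn_closure le_rfl)
  -- The bound passes to subsets and finite unions, so compactness reduces it to a neighbourhood of
  -- each point of the closure.
  have key : ∃ C, 0 ≤ C ∧ ∀ x ∈ closure Ω.carrier, x ∈ Ω.carrier → |g x| ≤ C * |Ω.ρ x| := by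
    refine Ω.isCompact_closure.induction_on
      (p := fun t => ∃ C, 0 ≤ C ∧ ∀ x ∈ t, x ∈ Ω.carrier → |g x| ≤ C * |Ω.ρ x|)
      ⟨0, le_rfl, by simp⟩ ?_ ?_ ?_
    · rintro s t hst ⟨C, hC, h⟩
      exact ⟨C, hC, fun x hx => h x (hst hx)⟩
    · rintro s t ⟨C, hC, h⟩ ⟨C', hC', h'⟩
      refine ⟨max C C', hC.trans (le_max_left _ _), ?_⟩
      rintro x (hx | hx) hxΩ
      · exact (h x hx hxΩ).trans (by gcongr; exact le_max_left _ _)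
      · exact (h' x hx hxΩ).trans (by gcongr; exact le_max_right _ _)
    intro x₀ hx₀
    by_cases hx₀Ω : x₀ ∈ Ω.carrier
    · have hρ : 0 < |Ω.ρ x₀| := abs_pos.2 (Ω.mem_carrier.1 hx₀Ω).ne
      have h1 : ∀ᶠ x in 𝓝[closure Ω.carrier] x₀, |g x| < |g x₀| + 1 :=
        (hg.continuousOn.abs x₀ hx₀).eventually_lt_const (lt_add_one _)
      have h2 : ∀ᶠ x in 𝓝[closure Ω.carrier] x₀, |Ω.ρ x₀| / 2 < |Ω.ρ x| :=
        (Ω.smooth_ρ.continuous.abs.continuousAt.eventually_const_lt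
          (half_lt_self hρ)).filter_mono nhdsWithin_le_nhds
      refine ⟨_, h1.and h2, (|g x₀| + 1) / (|Ω.ρ x₀| / 2), by positivity, ?_⟩
      rintro x ⟨hx1, hx2⟩ -
      rw [div_mul_eq_mul_div, le_div_iff₀ (by positivity)]
      exact mul_le_mul hx1.le hx2.le (by positivity) (by positivity)
    have hρ0 : Ω.ρ x₀ = 0 :=
      le_antisymm (Ω.ρ_nonpos hx₀) (not_lt.1 fun h => hx₀Ω (Ω.mem_carrier.2 h))
    set v := ∇ Ω.ρ x₀
    -- Half of the growth rate at `x₀`, so that the rate stays above `c` on a whole ball.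
    set c := fderiv ℝ Ω.ρ x₀ v / 2 with hc
    have hpos : 0 < fderiv ℝ Ω.ρ x₀ v := Ω.fderiv_ρ_gradient_pos hρ0
    have hc0 : 0 < c := half_pos hpos
    have hA : ∀ᶠ y in 𝓝 x₀, c < fderiv ℝ Ω.ρ y v :=
      (Ω.continuous_fderiv_ρ.clm_apply continuous_const).continuousAt.eventually_const_lt
        (half_lt_self hpos)
    obtain ⟨r, hr, hball⟩ := Metric.eventually_nhds_iff_ball.1 hA
    have hB : ∀ᶠ x in 𝓝 x₀, dist x x₀ < r / 2 :=
      Metric.ball_mem_nhds x₀ (half_pos hr)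
    -- The exit segment has length at most `-ρ x / c * ‖v‖`, which tends to `0` at `x₀`; near `x₀`
    -- it therefore stays in the ball where the rate is controlled.
    have hCev : ∀ᶠ x in 𝓝 x₀, -Ω.ρ x / c * ‖v‖ < r / 2 := by
      have : Continuous fun x => -Ω.ρ x / c * ‖v‖ :=
        (Ω.smooth_ρ.continuous.neg.div_const c).mul continuous_const
      refine this.continuousAt.eventually_lt_const ?_
      simpa [hρ0] using hr
    refine ⟨_, (hB.and hCev).filter_mono nhdsWithin_le_nhds, |K| * (‖v‖ / c), by positivity, ?_⟩
    rintro x ⟨hx1, hx2⟩ hxΩ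
    have hxneg := Ω.mem_carrier.1 hxΩ
    obtain ⟨s, hs, hfr, hseg⟩ := Ω.exists_exit (v := v) hc0 hxΩ (fun s hs => by
      refine (hball _ ?_).le
      have h1 : ‖s • v‖ ≤ -Ω.ρ x / c * ‖v‖ := by
        rw [norm_smul, Real.norm_of_nonneg hs.1]
        gcongr
        exact hs.2
      rw [Metric.mem_ball, dist_eq_norm, add_sub_right_comm]
      calc ‖x - x₀ + s • v‖ ≤ ‖x - x₀‖ + ‖s • v‖ := norm_add_le _ _
        _ < r / 2 + r / 2 := by
          rw [dist_eq_norm] at hx1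
          exact add_lt_add hx1 (h1.trans_lt hx2)
        _ = r := add_halves r)
    -- Mean value inequality from `x` to the exit point, where `g` vanishes: `|g x|` is at most
    -- `|K|` times the length of the segment, itself `O(|ρ x|)`.
    have hmv := (convex_segment x (x + s • v)).norm_image_sub_le_of_norm_hasFDerivWithin_le
      (f := g) (f' := fderivWithin ℝ g (closure Ω.carrier)) (C := |K|)
      (fun y hy => (((hg.differentiableOn one_ne_zero) y
        (hseg hy)).hasFDerivWithinAt).mono hseg)
      (fun y hy => (hK y (hseg hy)).trans (le_abs_self K))
      (right_mem_segment ℝ x (x + s • v)) (left_mem_segment ℝ x (x + s • v))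
    rw [hg0 _ hfr, sub_zero, Real.norm_eq_abs] at hmv
    refine hmv.trans ?_
    rw [mul_assoc]
    gcongr
    rw [sub_add_cancel_left, norm_neg, norm_smul, Real.norm_of_nonneg hs.1, abs_of_neg hxneg]
    calc s * ‖v‖ ≤ -Ω.ρ x / c * ‖v‖ := by gcongr; exact hs.2
      _ = ‖v‖ / c * -Ω.ρ x := by ring
  obtain ⟨C, hC, h⟩ := key
  exact ⟨C, hC, fun x hx => h x (subset_closure hx) hx⟩

end Geometry

end NewtonLeipnik

namespace NewtonLeipnik

/-! ### Divergence theorem for tangential fields -/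

noncomputable section Divergence

variable {n : ℕ} (Ω : SmoothBoundedDomain n)

/-- Integration by parts against the constant function `1`. -/
lemma integral_fderiv_eq_zero_of_hasCompactSupport {f : EuclideanSpace ℝ (Fin n) → ℝ}
    (hf : ContDiff ℝ 1 f) (hs : HasCompactSupport f) (v : EuclideanSpace ℝ (Fin n)) :
    ∫ x, fderiv ℝ f x v = 0 := by
  have hint : Integrable fun x => fderiv ℝ f x v :=
    ((hf.continuous_fderiv one_ne_zero).clm_apply continuous_const).integrable_of_hasCompactSupport
      (hs.fderiv_apply ℝ v)
  have := integral_mul_fderiv_eq_neg_fderiv_mul_of_integrable (μ := volume)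
    (f := fun _ : EuclideanSpace ℝ (Fin n) => (1 : ℝ)) (g := f) (v := v)
    (by simp) (by simpa using hint)
    (by simpa using hf.continuous.integrable_of_hasCompactSupport hs)
    (fun x _ => differentiableAt_const _) (fun x _ => hf.differentiable one_ne_zero x)
  simpa using this

/-- The coordinate derivative in the `i`-th direction. -/
def partialDeriv (i : Fin n) (f : EuclideanSpace ℝ (Fin n) → ℝ)
    (x : EuclideanSpace ℝ (Fin n)) : ℝ :=
  fderiv ℝ f x (EuclideanSpace.single i 1)

lemma SmoothBoundedDomain.closure_mem_nhds {x : EuclideanSpace ℝ (Fin n)} (hx : x ∈ Ω.carrier) :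
    closure Ω.carrier ∈ 𝓝 x :=
  mem_of_superset (Ω.isOpen_carrier.mem_nhds hx) subset_closure

lemma SmoothBoundedDomain.integrableOn {f : EuclideanSpace ℝ (Fin n) → ℝ}
    (hf : ContinuousOn f (closure Ω.carrier)) : IntegrableOn f Ω.carrier :=
  (hf.integrableOn_compact Ω.isCompact_closure).mono_set subset_closure

/-- A cutoff function supported in `{N ρ ≤ -1}` and equal to `1` on `{N ρ ≤ -2}`. -/
def SmoothBoundedDomain.cutoff (N : ℝ) (x : EuclideanSpace ℝ (Fin n)) : ℝ :=
  Real.smoothTransition (-N * Ω.ρ x - 1)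

lemma SmoothBoundedDomain.contDiff_cutoff (N : ℝ) : ContDiff ℝ ∞ (Ω.cutoff N) :=
  (Real.smoothTransition.contDiff (n := ⊤)).comp
    ((contDiff_const.mul Ω.smooth_ρ).sub contDiff_const)

lemma SmoothBoundedDomain.fderiv_cutoff (N : ℝ) (x v : EuclideanSpace ℝ (Fin n)) :
    fderiv ℝ (Ω.cutoff N) x v =
      -N * deriv Real.smoothTransition (-N * Ω.ρ x - 1) * fderiv ℝ Ω.ρ x v := by
  have h1 : HasFDerivAt (fun x => -N * Ω.ρ x - 1) ((-N) • fderiv ℝ Ω.ρ x) x :=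
    ((Ω.differentiable_ρ x).hasFDerivAt.const_mul (-N)).sub_const 1
  have h2 : HasDerivAt Real.smoothTransition (deriv Real.smoothTransition (-N * Ω.ρ x - 1))
      (-N * Ω.ρ x - 1) :=
    ((Real.smoothTransition.contDiff (n := 1)).differentiable one_ne_zero _).hasDerivAt
  have h3 : HasFDerivAt (Ω.cutoff N) _ x := h2.comp_hasFDerivAt x h1
  rw [h3.fderiv]
  simp only [smul_apply, smul_eq_mul]
  ring

lemma SmoothBoundedDomain.cutoff_eq_zero {N : ℝ} {x : EuclideanSpace ℝ (Fin n)}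
    (h : -N * Ω.ρ x ≤ 1) : Ω.cutoff N x = 0 :=
  Real.smoothTransition.zero_of_nonpos (by linarith)

lemma SmoothBoundedDomain.cutoff_eq_one {N : ℝ} {x : EuclideanSpace ℝ (Fin n)}
    (h : 2 ≤ -N * Ω.ρ x) : Ω.cutoff N x = 1 :=
  Real.smoothTransition.one_of_one_le (by linarith)

lemma deriv_smoothTransition_of_one_lt {s : ℝ} (hs : 1 < s) :
    deriv Real.smoothTransition s = 0 := by
  have : Real.smoothTransition =ᶠ[𝓝 s] fun _ => 1 := by
    filter_upwards [lt_mem_nhds hs] with y hy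
    exact Real.smoothTransition.one_of_one_le hy.le
  rw [this.deriv_eq, deriv_const]

lemma deriv_smoothTransition_of_neg {s : ℝ} (hs : s < 0) :
    deriv Real.smoothTransition s = 0 := by
  have : Real.smoothTransition =ᶠ[𝓝 s] fun _ => 0 := by
    filter_upwards [gt_mem_nhds hs] with y hy
    exact Real.smoothTransition.zero_of_nonpos hy.le
  rw [this.deriv_eq, deriv_const]

lemma exists_abs_deriv_smoothTransition_le :
    ∃ M, 0 ≤ M ∧ ∀ s, |deriv Real.smoothTransition s| ≤ M := by
  obtain ⟨M, hM⟩ := (isCompact_Icc (a := (0 : ℝ)) (b := 1)).exists_bound_of_continuousOn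
    ((Real.smoothTransition.contDiff (n := 1)).continuous_deriv le_rfl).continuousOn
  refine ⟨|M|, abs_nonneg M, fun s => ?_⟩
  by_cases h0 : s < 0
  · rw [deriv_smoothTransition_of_neg h0, abs_zero]; exact abs_nonneg M
  by_cases h1 : 1 < s
  · rw [deriv_smoothTransition_of_one_lt h1, abs_zero]; exact abs_nonneg M
  exact (hM s ⟨not_lt.1 h0, not_lt.1 h1⟩).trans (le_abs_self M)

/-- Off the domain `-N * ρ ≤ 0 < 1`, so the cutoff vanishes in a neighbourhood and the values of `f`
there do not matter. -/
lemma SmoothBoundedDomain.contDiff_cutoff_mul {N : ℝ} (hN : 0 < N)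
    {f : EuclideanSpace ℝ (Fin n) → ℝ} (hf : ContDiffOn ℝ 1 f (closure Ω.carrier)) :
    ContDiff ℝ 1 fun x => Ω.cutoff N x * f x := by
  rw [contDiff_iff_contDiffAt]
  intro x
  by_cases hx : x ∈ Ω.carrier
  · exact ((Ω.contDiff_cutoff N).of_le (by simp)).contDiffAt.mul
      (hf.contDiffAt (Ω.closure_mem_nhds hx))
  · have hx' : -N * Ω.ρ x < 1 := by
      rw [Ω.mem_carrier, not_lt] at hx
      nlinarith
    have hev : ∀ᶠ y in 𝓝 x, -N * Ω.ρ y < 1 :=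
      (continuous_const.mul Ω.smooth_ρ.continuous).continuousAt.eventually_lt_const hx'
    refine (contDiffAt_const (c := (0 : ℝ))).congr_of_eventuallyEq ?_
    filter_upwards [hev] with y hy
    rw [Ω.cutoff_eq_zero hy.le, zero_mul]

lemma SmoothBoundedDomain.hasCompactSupport_cutoff_mul {N : ℝ} (hN : 0 < N)
    (f : EuclideanSpace ℝ (Fin n) → ℝ) :
    HasCompactSupport fun x => Ω.cutoff N x * f x := by
  refine HasCompactSupport.intro Ω.isCompact_closure fun x hx => ?_
  have hx' : x ∉ Ω.carrier := fun h => hx (subset_closure h)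
  rw [Ω.mem_carrier, not_lt] at hx'
  rw [Ω.cutoff_eq_zero (by nlinarith), zero_mul]

lemma SmoothBoundedDomain.setIntegral_partialDeriv_cutoff_mul {N : ℝ} (hN : 0 < N)
    {f : EuclideanSpace ℝ (Fin n) → ℝ} (hf : ContDiffOn ℝ 1 f (closure Ω.carrier)) (i : Fin n) :
    ∫ x in Ω.carrier, partialDeriv i (fun x => Ω.cutoff N x * f x) x = 0 := by
  rw [setIntegral_eq_integral_of_forall_compl_eq_zero]
  · exact integral_fderiv_eq_zero_of_hasCompactSupport (Ω.contDiff_cutoff_mul hN hf)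
      (Ω.hasCompactSupport_cutoff_mul hN f) _
  · intro x hx
    rw [Ω.mem_carrier, not_lt] at hx
    have hx' : -N * Ω.ρ x < 1 := by nlinarith
    have hev : ∀ᶠ y in 𝓝 x, -N * Ω.ρ y < 1 :=
      (continuous_const.mul Ω.smooth_ρ.continuous).continuousAt.eventually_lt_const hx'
    have : (fun x => Ω.cutoff N x * f x) =ᶠ[𝓝 x] fun _ => 0 := by
      filter_upwards [hev] with y hy
      rw [Ω.cutoff_eq_zero hy.le, zero_mul]
    rw [partialDeriv, this.fderiv_eq]
    simp

/-- The coordinate derivative relative to `Ω̄`. -/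
def SmoothBoundedDomain.partialDerivWithin (i : Fin n) (f : EuclideanSpace ℝ (Fin n) → ℝ)
    (x : EuclideanSpace ℝ (Fin n)) : ℝ :=
  fderivWithin ℝ f (closure Ω.carrier) x (EuclideanSpace.single i 1)

lemma SmoothBoundedDomain.partialDerivWithin_eq {x : EuclideanSpace ℝ (Fin n)}
    (hx : x ∈ Ω.carrier) (i : Fin n) (f : EuclideanSpace ℝ (Fin n) → ℝ) :
    Ω.partialDerivWithin i f x = partialDeriv i f x := by
  rw [partialDerivWithin, partialDeriv, fderivWithin_of_mem_nhds (Ω.closure_mem_nhds hx)]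

lemma SmoothBoundedDomain.contDiffOn_partialDerivWithin {m k : ℕ∞}
    {f : EuclideanSpace ℝ (Fin n) → ℝ} (hf : ContDiffOn ℝ m f (closure Ω.carrier))
    (hk : k + 1 ≤ m) (i : Fin n) :
    ContDiffOn ℝ k (Ω.partialDerivWithin i f) (closure Ω.carrier) :=
  (hf.fderivWithin Ω.uniqueDiffOn_closure (by exact_mod_cast hk)).clm_apply contDiffOn_const

/-- The **divergence theorem** for `C¹` vector fields on `Ω̄` that are tangent to the boundary. -/
theorem SmoothBoundedDomain.integral_divergence_eq_zero
    {G : Fin n → EuclideanSpace ℝ (Fin n) → ℝ}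
    (hG : ∀ i, ContDiffOn ℝ 1 (G i) (closure Ω.carrier))
    (hν : ∀ x ∈ frontier Ω.carrier, ∑ i, G i x * partialDeriv i Ω.ρ x = 0) :
    ∫ x in Ω.carrier, ∑ i, Ω.partialDerivWithin i (G i) x = 0 := by
  set D : EuclideanSpace ℝ (Fin n) → ℝ := fun x => ∑ i, Ω.partialDerivWithin i (G i) x with hD
  set g : EuclideanSpace ℝ (Fin n) → ℝ := fun x => ∑ i, G i x * partialDeriv i Ω.ρ x with hg
  have hρ1 : ∀ i, ContDiff ℝ 1 (partialDeriv i Ω.ρ) := fun i =>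
    (Ω.smooth_ρ.fderiv_right (m := 1) (by norm_cast)).clm_apply contDiff_const
  have hgC : ContDiffOn ℝ 1 g (closure Ω.carrier) :=
    ContDiffOn.sum fun i _ => (hG i).mul (hρ1 i).contDiffOn
  have hDc : ContinuousOn D (closure Ω.carrier) := continuousOn_finsetSum _ fun i _ =>
    (Ω.contDiffOn_partialDerivWithin (m := 1) (k := 0) (hG i) (by simp) i).continuousOn
  obtain ⟨C, hC, hgρ⟩ := Ω.exists_abs_le_mul_abs_ρ hgC hν
  obtain ⟨M, hM, hη⟩ := exists_abs_deriv_smoothTransition_le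
  obtain ⟨K, hK⟩ := Ω.isCompact_closure.exists_bound_of_continuousOn hDc
  set η' := deriv Real.smoothTransition with hη'
  have hη'c : Continuous η' := (Real.smoothTransition.contDiff (n := 1)).continuous_deriv le_rfl
  have hmeas := Ω.isOpen_carrier.measurableSet
  have hfin : volume Ω.carrier ≠ ⊤ := Ω.isBounded.measure_lt_top.ne
  -- The threshold `2` puts the argument `-(N + 1) * ρ x - 1` beyond `1`, where the transition
  -- equals `1` and its derivative is `0`.
  have hev : ∀ x ∈ Ω.carrier, ∀ᶠ N : ℕ in atTop, 2 < -((N : ℝ) + 1) * Ω.ρ x := by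
    intro x hx
    have hx' : 0 < -Ω.ρ x := neg_pos.2 (Ω.mem_carrier.1 hx)
    have h1 : Tendsto (fun N : ℕ => ((N : ℝ) + 1) * -Ω.ρ x) atTop atTop :=
      (tendsto_natCast_atTop_atTop.atTop_add tendsto_const_nhds).atTop_mul_const hx'
    filter_upwards [h1.eventually_gt_atTop 2] with N hN
    linarith
  -- the identity for the truncated field
  have hid : ∀ N : ℕ, ∫ x in Ω.carrier, Ω.cutoff ((N : ℝ) + 1) x * D x =
      ∫ x in Ω.carrier, ((N : ℝ) + 1) * η' (-((N : ℝ) + 1) * Ω.ρ x - 1) * g x := by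
    intro N
    have hN : (0 : ℝ) < (N : ℝ) + 1 := by positivity
    set N' : ℝ := (N : ℝ) + 1
    have h1 : IntegrableOn (fun x => Ω.cutoff N' x * D x) Ω.carrier :=
      Ω.integrableOn ((Ω.contDiff_cutoff N').continuous.continuousOn.mul hDc)
    have h2 : IntegrableOn (fun x => N' * η' (-N' * Ω.ρ x - 1) * g x) Ω.carrier := by
      refine Ω.integrableOn (ContinuousOn.mul (Continuous.continuousOn ?_) hgC.continuousOn)
      exact continuous_const.mul (hη'c.comp
        ((continuous_const.mul Ω.smooth_ρ.continuous).sub continuous_const))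
    rw [← sub_eq_zero, ← integral_sub h1 h2]
    have h3 : ∫ x in Ω.carrier, ∑ i, partialDeriv i (fun x => Ω.cutoff N' x * G i x) x = 0 := by
      rw [integral_finsetSum]
      · exact Finset.sum_eq_zero fun i _ => Ω.setIntegral_partialDeriv_cutoff_mul hN (hG i) i
      · intro i _
        exact Ω.integrableOn (((Ω.contDiff_cutoff_mul hN (hG i)).continuous_fderiv
          one_ne_zero).clm_apply continuous_const).continuousOn
    rw [← h3]
    refine setIntegral_congr_fun hmeas fun x hx => ?_
    have hprod : ∀ i, partialDeriv i (fun x => Ω.cutoff N' x * G i x) x =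
        Ω.cutoff N' x * Ω.partialDerivWithin i (G i) x -
          N' * η' (-N' * Ω.ρ x - 1) * (G i x * partialDeriv i Ω.ρ x) := by
      intro i
      have hc : DifferentiableAt ℝ (Ω.cutoff N') x :=
        (Ω.contDiff_cutoff N').differentiable (by simp) x
      have hGi : DifferentiableAt ℝ (G i) x :=
        ((hG i).contDiffAt (Ω.closure_mem_nhds hx)).differentiableAt one_ne_zero
      rw [Ω.partialDerivWithin_eq hx]
      simp only [partialDeriv]
      rw [fderiv_fun_mul hc hGi]
      simp only [add_apply, smul_apply, smul_eq_mul,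
        Ω.fderiv_cutoff]
      ring
    simp only [hprod, Finset.sum_sub_distrib, ← Finset.mul_sum, hD, hg]
  have hL : Tendsto (fun N : ℕ => ∫ x in Ω.carrier, Ω.cutoff ((N : ℝ) + 1) x * D x) atTop
      (𝓝 (∫ x in Ω.carrier, D x)) := by
    refine tendsto_integral_of_dominated_convergence (fun _ => |K|) (fun N => ?_)
      (integrableOn_const hfin) (fun N => ?_) ?_
    · exact ((Ω.contDiff_cutoff _).continuous.continuousOn.mul
        (hDc.mono subset_closure)).aestronglyMeasurable hmeas
    · refine (ae_restrict_mem hmeas).mono fun x hx => ?_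
      rw [norm_mul, ← one_mul |K|]
      refine mul_le_mul ?_ ((hK x (subset_closure hx)).trans (le_abs_self K)) (norm_nonneg _)
        zero_le_one
      rw [SmoothBoundedDomain.cutoff, Real.norm_of_nonneg (Real.smoothTransition.nonneg _)]
      exact Real.smoothTransition.le_one _
    · refine (ae_restrict_mem hmeas).mono fun x hx => ?_
      refine tendsto_const_nhds.congr' ?_
      filter_upwards [hev x hx] with N hN
      rw [Ω.cutoff_eq_one hN.le, one_mul]
  have hR : Tendsto (fun N : ℕ => ∫ x in Ω.carrier,
      ((N : ℝ) + 1) * η' (-((N : ℝ) + 1) * Ω.ρ x - 1) * g x) atTop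
      (𝓝 (∫ _ in Ω.carrier, (0 : ℝ))) := by
    refine tendsto_integral_of_dominated_convergence (fun _ => 2 * M * C) (fun N => ?_)
      (integrableOn_const hfin) (fun N => ?_) ?_
    · refine ContinuousOn.aestronglyMeasurable (ContinuousOn.mul (Continuous.continuousOn ?_)
        (hgC.continuousOn.mono subset_closure)) hmeas
      exact continuous_const.mul (hη'c.comp
        ((continuous_const.mul Ω.smooth_ρ.continuous).sub continuous_const))
    · refine (ae_restrict_mem hmeas).mono fun x hx => ?_
      have hN : (0 : ℝ) < (N : ℝ) + 1 := by positivity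
      by_cases h : 1 < -((N : ℝ) + 1) * Ω.ρ x - 1
      · rw [hη', deriv_smoothTransition_of_one_lt h, mul_zero, zero_mul, norm_zero]
        positivity
      -- Where `η'` can be nonzero, `(N + 1) * |ρ| ≤ 2`; together with `|g| ≤ C * |ρ|` this absorbs
      -- the factor `N + 1`.
      · have hb : ((N : ℝ) + 1) * |Ω.ρ x| ≤ 2 := by
          rw [abs_of_neg (Ω.mem_carrier.1 hx)]
          linarith
        rw [norm_mul, norm_mul, Real.norm_of_nonneg hN.le, Real.norm_eq_abs, Real.norm_eq_abs]
        calc ((N : ℝ) + 1) * |η' (-((N : ℝ) + 1) * Ω.ρ x - 1)| * |g x|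
            ≤ ((N : ℝ) + 1) * M * (C * |Ω.ρ x|) := by
              gcongr
              · exact hη _
              · exact hgρ x hx
          _ = ((N : ℝ) + 1) * |Ω.ρ x| * (M * C) := by ring
          _ ≤ 2 * (M * C) := by gcongr
          _ = 2 * M * C := by ring
    · refine (ae_restrict_mem hmeas).mono fun x hx => ?_
      refine tendsto_const_nhds.congr' ?_
      filter_upwards [hev x hx] with N hN
      rw [hη', deriv_smoothTransition_of_one_lt (by linarith), mul_zero, zero_mul]
  rw [integral_zero] at hR
  simp only [hid] at hL
  exact tendsto_nhds_unique hL hR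

end Divergence

/-! ### Green's identity under the Neumann condition -/

section Green

variable {n : ℕ} (Ω : SmoothBoundedDomain n)

lemma SmoothBoundedDomain.gradient_ρ_eq_sum (x : EuclideanSpace ℝ (Fin n)) :
    ∇ Ω.ρ x = ∑ i, partialDeriv i Ω.ρ x • EuclideanSpace.single i (1 : ℝ) := by
  have h := (EuclideanSpace.basisFun (Fin n) ℝ).sum_repr' (∇ Ω.ρ x)
  rw [← h]
  refine Finset.sum_congr rfl fun i _ => ?_
  rw [partialDeriv, Ω.fderiv_ρ_apply, EuclideanSpace.basisFun_apply, real_inner_comm]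

lemma NeumannCondition.sum_eq_zero {Ω : SmoothBoundedDomain n}
    {w : EuclideanSpace ℝ (Fin n) → ℝ} (hw : NeumannCondition Ω w)
    {x : EuclideanSpace ℝ (Fin n)} (hx : x ∈ frontier Ω.carrier) :
    ∑ i, Ω.partialDerivWithin i w x * partialDeriv i Ω.ρ x = 0 := by
  have h := hw x hx
  have hne : ‖∇ Ω.ρ x‖⁻¹ ≠ 0 :=
    inv_ne_zero (norm_ne_zero_iff.2 (Ω.regular x (Ω.mem_frontier_iff.1 hx).2))
  rw [SmoothBoundedDomain.normal, map_smul, smul_eq_mul, mul_eq_zero, or_iff_right hne,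
    Ω.gradient_ρ_eq_sum, map_sum] at h
  rw [← h]
  refine Finset.sum_congr rfl fun i _ => ?_
  rw [map_smul, smul_eq_mul, mul_comm, SmoothBoundedDomain.partialDerivWithin]

lemma SmoothBoundedDomain.laplacian_eq_sum {w : EuclideanSpace ℝ (Fin n) → ℝ}
    (hw : ContDiffOn ℝ 2 w (closure Ω.carrier)) {x : EuclideanSpace ℝ (Fin n)}
    (hx : x ∈ Ω.carrier) :
    Laplacian.laplacian w x =
      ∑ i, Ω.partialDerivWithin i (Ω.partialDerivWithin i w) x := by
  rw [InnerProductSpace.laplacian_eq_iteratedFDeriv_orthonormalBasis w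
    (EuclideanSpace.basisFun (Fin n) ℝ)]
  refine Finset.sum_congr rfl fun i _ => ?_
  have hev : Ω.partialDerivWithin i w =ᶠ[𝓝 x] partialDeriv i w := by
    filter_upwards [Ω.isOpen_carrier.mem_nhds hx] with y hy
    exact Ω.partialDerivWithin_eq hy i w
  have hd : DifferentiableAt ℝ (fderiv ℝ w) x :=
    ((hw.contDiffAt (Ω.closure_mem_nhds hx)).fderiv_right (m := 1)
      (by norm_num)).differentiableAt one_ne_zero
  rw [Ω.partialDerivWithin_eq hx, partialDeriv, hev.fderiv_eq, iteratedFDeriv_two_apply]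
  change _ = fderiv ℝ (fun y => fderiv ℝ w y (EuclideanSpace.single i 1)) x _
  rw [fderiv_clm_apply hd (differentiableAt_const _)]
  simp

/-- The full Laplacian is uncontrolled on the boundary, so it is replaced inside the domain by
iterated derivatives relative to the closure, which are continuous on a compact set. -/
lemma SmoothBoundedDomain.integrableOn_mul_laplacian {w : EuclideanSpace ℝ (Fin n) → ℝ}
    (hw : ContDiffOn ℝ 2 w (closure Ω.carrier)) :
    IntegrableOn (fun x => w x * Laplacian.laplacian w x) Ω.carrier := by
  have h : IntegrableOn
      (fun x => w x * ∑ i, Ω.partialDerivWithin i (Ω.partialDerivWithin i w) x) Ω.carrier :=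
    Ω.integrableOn (hw.continuousOn.mul (continuousOn_finsetSum _ fun i _ =>
      (Ω.contDiffOn_partialDerivWithin (m := 1) (k := 0)
        (Ω.contDiffOn_partialDerivWithin (m := 2) (k := 1) hw (by norm_num) i)
        (by simp) i).continuousOn))
  refine h.congr_fun (fun x hx => ?_) Ω.isOpen_carrier.measurableSet
  simp only [Ω.laplacian_eq_sum hw hx]

/-- **Green's identity** for a function satisfying the Neumann condition. -/
theorem SmoothBoundedDomain.integral_mul_laplacian {w : EuclideanSpace ℝ (Fin n) → ℝ}
    (hw : ContDiffOn ℝ 2 w (closure Ω.carrier)) (hν : NeumannCondition Ω w) :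
    ∫ x in Ω.carrier, w x * Laplacian.laplacian w x =
      -∫ x in Ω.carrier, ∑ i, Ω.partialDerivWithin i w x ^ 2 := by
  have hw1 : ∀ i, ContDiffOn ℝ 1 (Ω.partialDerivWithin i w) (closure Ω.carrier) := fun i =>
    Ω.contDiffOn_partialDerivWithin (m := 2) (k := 1) hw (by norm_num) i
  -- The field is `w ∇w`, tangential because `∇w · ∇ρ = 0` on the boundary.
  have hdiv := Ω.integral_divergence_eq_zero (G := fun i x => w x * Ω.partialDerivWithin i w x)
    (fun i => (hw.of_le (by norm_num)).mul (hw1 i))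
    (fun x hx => by
      simp only [mul_assoc, ← Finset.mul_sum, hν.sum_eq_zero hx, mul_zero])
  have hint : IntegrableOn (fun x => ∑ i, Ω.partialDerivWithin i w x ^ 2) Ω.carrier :=
    Ω.integrableOn (continuousOn_finsetSum _ fun i _ => (hw1 i).continuousOn.pow 2)
  rw [eq_neg_iff_add_eq_zero, ← integral_add (Ω.integrableOn_mul_laplacian hw) hint, ← hdiv]
  refine setIntegral_congr_fun Ω.isOpen_carrier.measurableSet fun x hx => ?_
  rw [Ω.laplacian_eq_sum hw hx, Finset.mul_sum, ← Finset.sum_add_distrib]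
  refine Finset.sum_congr rfl fun i _ => ?_
  have hd : DifferentiableAt ℝ w x :=
    (hw.contDiffAt (Ω.closure_mem_nhds hx)).differentiableAt two_ne_zero
  have hd1 : DifferentiableAt ℝ (Ω.partialDerivWithin i w) x :=
    ((hw1 i).contDiffAt (Ω.closure_mem_nhds hx)).differentiableAt one_ne_zero
  rw [Ω.partialDerivWithin_eq hx i (fun x => w x * Ω.partialDerivWithin i w x),
    Ω.partialDerivWithin_eq hx i (Ω.partialDerivWithin i w), partialDeriv, partialDeriv,
    fderiv_fun_mul hd hd1]
  simp only [add_apply, smul_apply, smul_eq_mul]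
  rw [Ω.partialDerivWithin_eq hx i w, partialDeriv]
  ring

lemma SmoothBoundedDomain.integral_mul_laplacian_nonpos {w : EuclideanSpace ℝ (Fin n) → ℝ}
    (hw : ContDiffOn ℝ 2 w (closure Ω.carrier)) (hν : NeumannCondition Ω w) :
    ∫ x in Ω.carrier, w x * Laplacian.laplacian w x ≤ 0 := by
  rw [Ω.integral_mul_laplacian hw hν, neg_nonpos]
  exact integral_nonneg fun x => Finset.sum_nonneg fun i _ => sq_nonneg _

end Green

end NewtonLeipnik

namespace NewtonLeipnik

/-! ### Energy estimate and exponential decay -/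

section Energy

variable {n : ℕ} (Ω : SmoothBoundedDomain n)

/-- A tube-lemma argument: the bound on the slice at `t`, enlarged by `1`, persists for nearby `s`
uniformly over the compact `K`. It supplies the dominating constants for the parameter integrals. -/
lemma eventually_norm_le_of_continuousOn_prod {X Y : Type*} [TopologicalSpace X]
    [TopologicalSpace Y] {S : Set X} {K : Set Y} (hK : IsCompact K) {f : X → Y → ℝ}
    (hf : ContinuousOn (fun p : X × Y => f p.1 p.2) (S ×ˢ K)) {t : X} (ht : t ∈ S) :
    ∃ C, ∀ᶠ s in 𝓝[S] t, ∀ y ∈ K, ‖f s y‖ ≤ C := by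
  have hft : ContinuousOn (f t) K :=
    hf.comp (f := fun y => (t, y)) (by fun_prop) fun y hy => ⟨ht, hy⟩
  obtain ⟨C, hC⟩ := hK.exists_bound_of_continuousOn hft
  refine ⟨C + 1, ?_⟩
  have h := hK.eventually_forall_of_forall_eventually (x₀ := t)
    (P := fun s y => s ∈ S → y ∈ K → ‖f s y‖ ≤ C + 1) (fun y hy => by
      have h1 : ∀ᶠ p in 𝓝[S ×ˢ K] (t, y), ‖f p.1 p.2‖ < C + 1 :=
        (hf (t, y) ⟨ht, hy⟩).norm.eventually_lt_const
          ((hC y hy).trans_lt (lt_add_one C))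
      rw [eventually_nhdsWithin_iff] at h1
      filter_upwards [h1] with p hp hp1 hp2
      exact (hp ⟨hp1, hp2⟩).le)
  rw [eventually_nhdsWithin_iff]
  filter_upwards [h] with s hs hsS y hy
  exact hs y hy hsS hy

lemma isOpen_openTimeInterval (T : EReal) : IsOpen (openTimeInterval T) :=
  (isOpen_lt continuous_const continuous_id).inter
    (isOpen_lt continuous_coe_real_ereal continuous_const)

lemma openTimeInterval_subset (T : EReal) : openTimeInterval T ⊆ timeInterval T :=
  fun _ ht => ⟨ht.1.le, ht.2⟩

lemma SmoothBoundedDomain.continuousOn_integral {S : Set ℝ}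
    {f : ℝ → EuclideanSpace ℝ (Fin n) → ℝ}
    (hf : ContinuousOn (fun p : ℝ × EuclideanSpace ℝ (Fin n) => f p.1 p.2)
      (S ×ˢ closure Ω.carrier)) :
    ContinuousOn (fun t => ∫ x in Ω.carrier, f t x) S := by
  intro t ht
  have hmeas := Ω.isOpen_carrier.measurableSet
  obtain ⟨C, hC⟩ := eventually_norm_le_of_continuousOn_prod Ω.isCompact_closure hf ht
  refine continuousWithinAt_of_dominated (bound := fun _ => C) ?_ ?_
    (integrableOn_const Ω.isBounded.measure_lt_top.ne) ?_
  · filter_upwards [self_mem_nhdsWithin] with s hs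
    refine ContinuousOn.aestronglyMeasurable ?_ hmeas
    exact hf.comp (f := fun y => (s, y)) (by fun_prop) fun y hy => ⟨hs, subset_closure hy⟩
  · filter_upwards [hC] with s hs
    exact (ae_restrict_mem hmeas).mono fun x hx => hs x (subset_closure hx)
  · refine (ae_restrict_mem hmeas).mono fun x hx => ?_
    exact (hf.comp (f := fun s => (s, x)) (by fun_prop)
      fun s hs => ⟨hs, subset_closure hx⟩) t ht

namespace ClassicalRegularity

variable {Ω} {T : EReal} {w : ℝ → EuclideanSpace ℝ (Fin n) → ℝ}

lemma continuousOn_slice (hw : ClassicalRegularity Ω T w) {t : ℝ} (ht : t ∈ timeInterval T) :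
    ContinuousOn (w t) (closure Ω.carrier) :=
  hw.continuousOn.comp (f := fun y => (t, y)) (by fun_prop) fun _ hy => ⟨ht, hy⟩

lemma continuousOn_deriv_slice (hw : ClassicalRegularity Ω T w) {t : ℝ}
    (ht : t ∈ openTimeInterval T) :
    ContinuousOn (fun x => deriv (fun s => w s x) t) (closure Ω.carrier) :=
  hw.continuousOn_deriv.comp (f := fun y => (t, y)) (by fun_prop) fun _ hy => ⟨ht, hy⟩

lemma continuousOn_integral_sq (hw : ClassicalRegularity Ω T w) :
    ContinuousOn (fun t => ∫ x in Ω.carrier, w t x ^ 2) (timeInterval T) :=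
  Ω.continuousOn_integral (f := fun t x => w t x ^ 2) (hw.continuousOn.pow 2)

lemma hasDerivAt_integral_sq (hw : ClassicalRegularity Ω T w) {t : ℝ}
    (ht : t ∈ openTimeInterval T) :
    HasDerivAt (fun t => ∫ x in Ω.carrier, w t x ^ 2)
      (∫ x in Ω.carrier, 2 * (w t x * deriv (fun s => w s x) t)) t := by
  have hmeas := Ω.isOpen_carrier.measurableSet
  have hopen := (isOpen_openTimeInterval T).mem_nhds ht
  have hF : ContinuousOn (fun p : ℝ × EuclideanSpace ℝ (Fin n) =>
      2 * (w p.1 p.2 * deriv (fun s => w s p.2) p.1))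
      (openTimeInterval T ×ˢ closure Ω.carrier) :=
    continuousOn_const.mul ((hw.continuousOn.mono
      (prod_mono (openTimeInterval_subset T) subset_rfl)).mul hw.continuousOn_deriv)
  obtain ⟨C, hC⟩ := eventually_norm_le_of_continuousOn_prod
    (f := fun t x => 2 * (w t x * deriv (fun s => w s x) t)) Ω.isCompact_closure hF ht
  rw [nhdsWithin_eq_nhds.2 hopen] at hC
  -- The neighbourhood of `t` is taken to be the set of times at which the uniform bound `C` holds.
  refine (hasDerivAt_integral_of_dominated_loc_of_deriv_le (μ := volume.restrict Ω.carrier)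
    (F := fun t x => w t x ^ 2) (F' := fun t x => 2 * (w t x * deriv (fun s => w s x) t))
    (bound := fun _ => C) (s := {s | s ∈ openTimeInterval T ∧ ∀ y ∈ closure Ω.carrier,
      ‖2 * (w s y * deriv (fun s => w s y) s)‖ ≤ C}) (inter_mem hopen hC) ?_ ?_ ?_ ?_
    (integrableOn_const Ω.isBounded.measure_lt_top.ne) ?_).2
  · filter_upwards [hopen] with s hs
    exact (((hw.continuousOn_slice (openTimeInterval_subset T hs)).mono
      subset_closure).pow 2).aestronglyMeasurable hmeas
  · exact Ω.integrableOn ((hw.continuousOn_slice (openTimeInterval_subset T ht)).pow 2)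
  · exact (Ω.integrableOn (continuousOn_const.mul ((hw.continuousOn_slice
      (openTimeInterval_subset T ht)).mul (hw.continuousOn_deriv_slice ht)))).1
  · exact (ae_restrict_mem hmeas).mono fun x hx s hs => hs.2 x (subset_closure hx)
  · refine (ae_restrict_mem hmeas).mono fun x hx s hs => ?_
    convert! (hw.differentiableAt_time s hs.1 x (subset_closure hx)).hasDerivAt.pow 2 using 1
    simp only [Nat.cast_ofNat]
    ring

end ClassicalRegularity

variable {Ω} {T : EReal} {d : Fin 3 → ℝ} {k : ℝ}
  {u e : Fin 3 → ℝ → EuclideanSpace ℝ (Fin n) → ℝ}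

/-- The off-diagonal part of the error matrix is skew-symmetric. -/
lemma sum_mul_errorMatrix_mulVec (k : ℝ) (u v w : Fin 3 → ℝ) :
    ∑ i, w i * (errorMatrix k u v).mulVec w i =
      -(0.4 * w 0 ^ 2 + 0.4 * w 1 ^ 2 + k * w 2 ^ 2) := by
  simp [errorMatrix, Matrix.mulVec, dotProduct, Fin.sum_univ_three]
  ring

/-- Multiply each equation by `2 eᵢ`, sum and integrate: skew-symmetry removes the coupling, the
diagonal dissipates at rate at least `min 0.4 k`, and the diffusion terms are nonpositive. -/
lemma IsErrorSolution.deriv_energy_le (he : IsErrorSolution Ω d k u T e) (hd : ∀ i, 0 < d i)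
    {t : ℝ} (ht : t ∈ openTimeInterval T) :
    ∑ i, ∫ x in Ω.carrier, 2 * (e i t x * deriv (fun s => e i s x) t) ≤
      -(2 * min 0.4 k) * ∑ i, ∫ x in Ω.carrier, e i t x ^ 2 := by
  have hmeas := Ω.isOpen_carrier.measurableSet
  have hcont : ∀ i, ContinuousOn (e i t) (closure Ω.carrier) := fun i =>
    (he.regularity i).continuousOn_slice (openTimeInterval_subset T ht)
  have hC2 : ∀ i, ContDiffOn ℝ 2 (e i t) (closure Ω.carrier) := fun i =>
    (he.regularity i).contDiffOn_space t ht
  have hi1 : ∀ i, IntegrableOn (fun x => 2 * (e i t x * deriv (fun s => e i s x) t))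
      Ω.carrier := fun i =>
    Ω.integrableOn (continuousOn_const.mul
      ((hcont i).mul ((he.regularity i).continuousOn_deriv_slice ht)))
  have hi2 : ∀ i, IntegrableOn (fun x => e i t x ^ 2) Ω.carrier := fun i =>
    Ω.integrableOn ((hcont i).pow 2)
  have hi3 : ∀ i, IntegrableOn
      (fun x => 2 * d i * (e i t x * Laplacian.laplacian (e i t) x)) Ω.carrier := fun i =>
    (Ω.integrableOn_mul_laplacian (hC2 i)).const_mul _
  have hi4 : IntegrableOn (fun x => ∑ i, 2 * d i * (e i t x * Laplacian.laplacian (e i t) x))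
      Ω.carrier := integrable_finsetSum _ fun i _ => hi3 i
  have hi5 : IntegrableOn (fun x => -(2 * min 0.4 k) * ∑ i, e i t x ^ 2) Ω.carrier :=
    (integrable_finsetSum _ fun i _ => hi2 i).const_mul _
  have hpt : ∀ x ∈ Ω.carrier, ∑ i, 2 * (e i t x * deriv (fun s => e i s x) t) ≤
      ∑ i, 2 * d i * (e i t x * Laplacian.laplacian (e i t) x) +
        -(2 * min 0.4 k) * ∑ i, e i t x ^ 2 := by
    intro x hx
    have heq := fun i => he.equation i t ht x hx
    have hskew := sum_mul_errorMatrix_mulVec k (fun j => u j t x) (fun j => u j t x + e j t x)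
      (fun j => e j t x)
    -- Replaces `A E` in the skew-symmetry identity by `∂ₜE - D ΔE`.
    simp only [← heq, Fin.sum_univ_three] at hskew ⊢
    have h1 := min_le_left 0.4 k
    have h2 := min_le_right 0.4 k
    have h3 := mul_le_mul_of_nonneg_right h1 (sq_nonneg (e 0 t x))
    have h4 := mul_le_mul_of_nonneg_right h1 (sq_nonneg (e 1 t x))
    have h5 := mul_le_mul_of_nonneg_right h2 (sq_nonneg (e 2 t x))
    linarith
  calc ∑ i, ∫ x in Ω.carrier, 2 * (e i t x * deriv (fun s => e i s x) t)
      = ∫ x in Ω.carrier, ∑ i, 2 * (e i t x * deriv (fun s => e i s x) t) :=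
        (integral_finsetSum _ fun i _ => hi1 i).symm
    _ ≤ ∫ x in Ω.carrier, (∑ i, 2 * d i * (e i t x * Laplacian.laplacian (e i t) x) +
          -(2 * min 0.4 k) * ∑ i, e i t x ^ 2) :=
        setIntegral_mono_on (integrable_finsetSum _ fun i _ => hi1 i) (hi4.add hi5) hmeas hpt
    _ = (∑ i, 2 * d i * ∫ x in Ω.carrier, e i t x * Laplacian.laplacian (e i t) x) +
          -(2 * min 0.4 k) * ∑ i, ∫ x in Ω.carrier, e i t x ^ 2 := by
        rw [integral_add hi4 hi5, integral_finsetSum _ fun i _ => hi3 i, integral_const_mul,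
          integral_finsetSum _ fun i _ => hi2 i]
        simp only [integral_const_mul]
    _ ≤ -(2 * min 0.4 k) * ∑ i, ∫ x in Ω.carrier, e i t x ^ 2 := by
        have : ∑ i, 2 * d i * ∫ x in Ω.carrier, e i t x * Laplacian.laplacian (e i t) x ≤ 0 :=
          Finset.sum_nonpos fun i _ => mul_nonpos_of_nonneg_of_nonpos
            (mul_nonneg zero_le_two (hd i).le)
            (Ω.integral_mul_laplacian_nonpos (hC2 i) (he.neumann i t ht))
        linarith

/-- The `L²` norm of the error decays exponentially. -/
theorem IsErrorSolution.l2Norm_le (he : IsErrorSolution Ω d k u T e) (hd : ∀ i, 0 < d i)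
    {t : ℝ} (ht : t ∈ timeInterval T) :
    l2Norm Ω (fun i => e i t) ≤
      Real.exp (-(min 0.4 k * t)) * l2Norm Ω (fun i => e i 0) := by
  set m := min 0.4 k
  set Φ : ℝ → ℝ := fun t => ∑ i, ∫ x in Ω.carrier, e i t x ^ 2
  have hsub : Icc 0 t ⊆ timeInterval T := fun s hs =>
    ⟨hs.1, (EReal.coe_le_coe_iff.2 hs.2).trans_lt ht.2⟩
  have hsub' : Ioo 0 t ⊆ openTimeInterval T := fun s hs =>
    ⟨hs.1, (EReal.coe_lt_coe_iff.2 hs.2).trans ht.2⟩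
  -- Grönwall with the integrating factor `exp (2 m s)`.
  have hd1 : ∀ s ∈ Ioo 0 t, HasDerivAt (fun s => Φ s * Real.exp (2 * m * s))
      ((∑ i, ∫ x in Ω.carrier, 2 * (e i s x * deriv (fun s => e i s x) s)) *
        Real.exp (2 * m * s) + Φ s * (Real.exp (2 * m * s) * (2 * m))) s := by
    intro s hs
    have h1 : HasDerivAt Φ
        (∑ i, ∫ x in Ω.carrier, 2 * (e i s x * deriv (fun s => e i s x) s)) s :=
      HasDerivAt.fun_sum fun i _ => (he.regularity i).hasDerivAt_integral_sq (hsub' hs)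
    have h2 : HasDerivAt (fun s : ℝ => 2 * m * s) (2 * m) s := by
      simpa using (hasDerivAt_id s).const_mul (2 * m)
    exact h1.mul h2.exp
  have hanti : AntitoneOn (fun s => Φ s * Real.exp (2 * m * s)) (Icc 0 t) := by
    -- The derivative is only available at positive times; continuity of the energy at `0` brings in
    -- the initial value.
    refine antitoneOn_of_deriv_nonpos (convex_Icc 0 t) ?_ ?_ ?_
    · refine ContinuousOn.mul (continuousOn_finsetSum _ fun i _ => ?_)
        (Continuous.continuousOn (by fun_prop))
      exact (he.regularity i).continuousOn_integral_sq.mono hsub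
    · rw [interior_Icc]
      exact fun s hs => (hd1 s hs).differentiableAt.differentiableWithinAt
    · rw [interior_Icc]
      intro s hs
      rw [(hd1 s hs).deriv]
      have h : _ ≤ -(2 * m) * Φ s * Real.exp (2 * m * s) := mul_le_mul_of_nonneg_right
        (he.deriv_energy_le hd (hsub' hs)) (Real.exp_pos (2 * m * s)).le
      linarith
  have hle := hanti (left_mem_Icc.2 ht.1) (right_mem_Icc.2 ht.1) ht.1
  simp only [mul_zero, Real.exp_zero, mul_one] at hle
  have hΦt : Φ t ≤ Real.exp (-(m * t)) ^ 2 * Φ 0 := by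
    have h1 : Real.exp (-(m * t)) ^ 2 * Real.exp (2 * m * t) = 1 := by
      rw [← Real.exp_nat_mul, ← Real.exp_add, Real.exp_eq_one_iff]
      push_cast
      ring
    calc Φ t = Real.exp (-(m * t)) ^ 2 * (Φ t * Real.exp (2 * m * t)) := by
          rw [mul_left_comm, h1, mul_one]
      _ ≤ Real.exp (-(m * t)) ^ 2 * Φ 0 := by gcongr
  calc l2Norm Ω (fun i => e i t) ≤ √(Real.exp (-(m * t)) ^ 2 * Φ 0) := Real.sqrt_le_sqrt hΦt
    _ = Real.exp (-(m * t)) * l2Norm Ω (fun i => e i 0) := by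
      rw [Real.sqrt_mul (sq_nonneg _), Real.sqrt_sq (Real.exp_pos _).le]
      rfl

lemma ClassicalRegularity.zero : ClassicalRegularity Ω T (fun _ _ => 0) where
  continuousOn := continuousOn_const
  contDiffOn_space _ _ := contDiffOn_const
  continuousOn_fderiv := by
    simp only [fderivWithin_fun_const]
    exact continuousOn_const
  continuousOn_fderiv_two := by
    simp only [iteratedFDerivWithin_const_of_ne two_ne_zero]
    exact continuousOn_const
  differentiableAt_time _ _ _ _ := differentiableAt_const _
  continuousOn_deriv := by
    simp only [deriv_const]
    exact continuousOn_const

lemma isErrorSolution_zero : IsErrorSolution Ω d k u T (fun _ _ _ => 0) where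
  regularity _ := ClassicalRegularity.zero
  equation i t _ x _ := by
    have h0 : (fun _ : Fin 3 => (0 : ℝ)) = 0 := rfl
    have hΔ : Laplacian.laplacian (fun _ : EuclideanSpace ℝ (Fin n) => (0 : ℝ)) = 0 :=
      InnerProductSpace.laplacian_const
    simp only [deriv_const, hΔ, h0, Matrix.mulVec_zero, Pi.zero_apply, mul_zero, sub_zero]
  neumann _ _ _ x _ := by simp

end Energy

end NewtonLeipnik

/-! ### Local asymptotic stability -/

theorem proposition2 {n : ℕ} (Ω : NewtonLeipnik.SmoothBoundedDomain n)
    (d : Fin 3 → ℝ) (hd : ∀ i, 0 < d i) (α k : ℝ) (hk : 0 < k)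
    (u : Fin 3 → ℝ → EuclideanSpace ℝ (Fin n) → ℝ)
    (hu : NewtonLeipnik.IsMasterSolution Ω d α u)
    (lam₁ : ℝ) (hlam₁ : NewtonLeipnik.IsFirstNonzeroNeumannEigenvalue Ω lam₁)
    (hcond : ∀ t : ℝ, 0 < t → ∀ x ∈ Ω.carrier,
      (0.52 + 100 * u 2 t x ^ 2 + 20 * u 2 t x) / (1.6 + 2 * k) < d 2 * lam₁) :
    NewtonLeipnik.ZeroLocallyAsymptoticallyStable Ω
      (fun T e => NewtonLeipnik.IsErrorSolution Ω d k u T e) := by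
  have hm : 0 < min 0.4 k := lt_min (by norm_num) hk
  -- The norm never exceeds its initial value, so `δ = ε` works for stability. Decay holds for all
  -- initial data, so the radius `1` for attraction is arbitrary.
  refine ⟨NewtonLeipnik.isErrorSolution_zero, fun ε hε => ⟨ε, hε, fun T e he h0 t ht => ?_⟩,
    1, one_pos, fun e he _ => ?_⟩
  · refine (he.l2Norm_le hd ht).trans_lt (lt_of_le_of_lt ?_ h0)
    refine mul_le_of_le_one_left (Real.sqrt_nonneg _) (Real.exp_le_one_iff.2 ?_)
    exact neg_nonpos.2 (mul_nonneg hm.le ht.1)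
  · have hexp : Tendsto (fun t : ℝ => Real.exp (-(min 0.4 k * t)) *
        NewtonLeipnik.l2Norm Ω (fun i => e i 0)) atTop (𝓝 0) := by
      have h1 : Tendsto (fun t : ℝ => min 0.4 k * t) atTop atTop :=
        tendsto_id.const_mul_atTop hm
      simpa using (Real.tendsto_exp_neg_atTop_nhds_zero.comp h1).mul_const
        (NewtonLeipnik.l2Norm Ω (fun i => e i 0))
    refine squeeze_zero' (Eventually.of_forall fun t => Real.sqrt_nonneg _) ?_ hexp
    filter_upwards [eventually_ge_atTop 0] with t ht
    exact he.l2Norm_le hd ⟨ht, EReal.coe_lt_top t⟩
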